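/- Let $n_0,p,\ell$ be integers with $p\ge 1$, $\ell\ge 0$ and $n_0>p$, and put $n_\ell=n_0 2^\ell$, $h_\ell=1/n_\ell$. Let $S_{p,\ell}(0,1)$ be the space of all functions in $C^{p-1}(0,1)$ that are polynomials of degree at most $p$ on each subinterval $((i-1)h_\ell,\,i h_\ell)$, $i=1,\dots,n_\ell$. Let $H^1(0,1)$ be the Sobolev space of real functions in $L^2(0,1)$ with weak derivative in $L^2(0,1)$, with inner product $(u,v)_A=(u',v')_{L^2(0,1)}+(u,v)_{L^2(0,1)}$ and norm $\|u\|_{H^1(0,1)}=(u,u)_A^{1/2}$, and let $T_\ell:H^1(0,1)\to S_{p,\ell}(0,1)$ be the $(\cdot,\cdot)_A$-orthogonal projector onto $S_{p,\ell}(0,1)$. Then there is a constant $c>0$, independent of $\ell$, $p$ and $n_0$, such that $$\|(I-T_\ell)u\|_{L^2(0,1)}\le c\,h_\ell\,\|u\|_{H^1(0,1)}\qquad\text{for all } u\in H^1(0,1).$$ -/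

import Mathlib

open MeasureTheory
open scoped ContDiff

noncomputable section

namespace SplineApprox

/-- The Lebesgue space `L²(0,1)` of real-valued functions. -/
abbrev L2 : Type := Lp ℝ 2 (volume.restrict (Set.Ioo (0 : ℝ) 1))

/-- `v` is the weak derivative of `u` on `(0,1)`:
`∫ u φ' = -∫ v φ` for all test functions `φ ∈ C_c^∞(0,1)`. -/
def IsWeakDeriv (u v : L2) : Prop :=
  ∀ φ : ℝ → ℝ, ContDiff ℝ ∞ φ → HasCompactSupport φ → tsupport φ ⊆ Set.Ioo (0 : ℝ) 1 →
    ∫ x in Set.Ioo (0 : ℝ) 1, u x * deriv φ x = -∫ x in Set.Ioo (0 : ℝ) 1, v x * φ x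

lemma integrable_mul_of_continuous (f : L2) {g : ℝ → ℝ} (hg : Continuous g)
    (hgs : HasCompactSupport g) :
    Integrable (fun x => f x * g x) (volume.restrict (Set.Ioo (0 : ℝ) 1)) := by
  have h1 : MemLp g 2 (volume.restrict (Set.Ioo (0 : ℝ) 1)) :=
    (hg.memLp_of_hasCompactSupport hgs (μ := volume)).restrict _
  exact (Lp.memLp f).integrable_mul h1

/-- The Sobolev space `H¹(0,1)`: functions in `L²(0,1)` with a weak derivative in `L²(0,1)`,
realised as the space of pairs `(u, u')` inside the Hilbert sum `L² ⊕ L²`. The inner product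
that it inherits is `(u, v)_A = (u', v')_{L²} + (u, v)_{L²}`, and its norm is the `H¹` norm. -/
def H1 : Submodule ℝ (WithLp 2 (L2 × L2)) where
  carrier := {w | IsWeakDeriv w.fst w.snd}
  zero_mem' := by
    intro φ _ _ _
    have h0 : ((0 : L2) : ℝ → ℝ) =ᵐ[volume.restrict (Set.Ioo (0 : ℝ) 1)] 0 :=
      Lp.coeFn_zero _ _ _
    have h1 : ∀ g : ℝ → ℝ, ∫ x in Set.Ioo (0 : ℝ) 1, (0 : L2) x * g x = 0 := by
      intro g
      refine integral_eq_zero_of_ae ?_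
      filter_upwards [h0] with x hx
      change (0 : L2) x * g x = 0
      rw [hx, Pi.zero_apply, zero_mul]
    change ∫ x in Set.Ioo (0 : ℝ) 1, (0 : L2) x * _ = -∫ x in Set.Ioo (0 : ℝ) 1, (0 : L2) x * _
    rw [h1, h1, neg_zero]
  add_mem' := by
    intro a b ha hb φ h1 h2 h3
    have key : ∀ (f g : L2) (ψ : ℝ → ℝ), Continuous ψ → HasCompactSupport ψ →
        ∫ x in Set.Ioo (0 : ℝ) 1, (f + g : L2) x * ψ x =
          (∫ x in Set.Ioo (0 : ℝ) 1, f x * ψ x) + ∫ x in Set.Ioo (0 : ℝ) 1, g x * ψ x := by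
      intro f g ψ hψ hψs
      rw [← integral_add (integrable_mul_of_continuous f hψ hψs)
        (integrable_mul_of_continuous g hψ hψs)]
      refine integral_congr_ae ?_
      filter_upwards [Lp.coeFn_add f g] with x hx
      rw [hx, Pi.add_apply, add_mul]
    change ∫ x in Set.Ioo (0 : ℝ) 1, (a.fst + b.fst : L2) x * _ =
      -∫ x in Set.Ioo (0 : ℝ) 1, (a.snd + b.snd : L2) x * _
    rw [key _ _ _ (h1.continuous_deriv (by simp)) h2.deriv, key _ _ _ h1.continuous h2,
      ha φ h1 h2 h3, hb φ h1 h2 h3]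
    ring
  smul_mem' := by
    intro c a ha φ h1 h2 h3
    have key : ∀ (f : L2) (ψ : ℝ → ℝ),
        ∫ x in Set.Ioo (0 : ℝ) 1, (c • f : L2) x * ψ x =
          c * ∫ x in Set.Ioo (0 : ℝ) 1, f x * ψ x := by
      intro f ψ
      rw [← integral_const_mul]
      refine integral_congr_ae ?_
      filter_upwards [Lp.coeFn_smul c f] with x hx
      rw [hx, Pi.smul_apply, smul_eq_mul, mul_assoc]
    change ∫ x in Set.Ioo (0 : ℝ) 1, (c • a.fst : L2) x * _ =
      -∫ x in Set.Ioo (0 : ℝ) 1, (c • a.snd : L2) x * _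
    rw [key, key, ha φ h1 h2 h3]
    ring

/-- The embedding `H¹(0,1) → L²(0,1)`, `u ↦ u`. -/
def toL2 : H1 →ₗ[ℝ] L2 :=
  WithLp.fstₗ (p := 2) (𝕜 := ℝ) (α := L2) (β := L2) ∘ₗ H1.subtype

/-- The number `n_ℓ = n₀ 2^ℓ` of subintervals on level `ℓ`. -/
def gridCount (n₀ ℓ : ℕ) : ℕ := n₀ * 2 ^ ℓ

/-- The grid size `h_ℓ = 1 / n_ℓ`. -/
def meshSize (n₀ ℓ : ℕ) : ℝ := 1 / (gridCount n₀ ℓ : ℝ)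

/-- `s` is, on `(0,1)`, a spline of degree `p ≥ 1` and maximum smoothness `C^{p-1}` over the uniform
grid of level `ℓ`: it is `C^{p-1}` on `(0,1)`, and it is a polynomial of degree at most `p` on
each subinterval `(i h_ℓ, (i+1) h_ℓ)`, `0 ≤ i < n_ℓ`. -/
def IsSpline (n₀ p ℓ : ℕ) (s : ℝ → ℝ) : Prop :=
  ContDiffOn ℝ ((p - 1 : ℕ) : ℕ∞) s (Set.Ioo 0 1) ∧
    ∀ i < gridCount n₀ ℓ, ∃ q : Polynomial ℝ, q.natDegree ≤ p ∧
      ∀ x ∈ Set.Ioo ((i : ℝ) * meshSize n₀ ℓ) (((i : ℝ) + 1) * meshSize n₀ ℓ), s x = q.eval x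

/-- The spline space `S_{p,ℓ}(0,1)` as a subspace of `H¹(0,1)`: the elements that are represented
by a spline. For `p ≥ 1` and `n₀ ≥ 1` a spline is continuous and piecewise polynomial,
so every spline represents an element of `H¹(0,1)`. -/
def splineSpace (n₀ p ℓ : ℕ) : Submodule ℝ H1 where
  carrier := {u | ∃ s : ℝ → ℝ, IsSpline n₀ p ℓ s ∧
    toL2 u =ᵐ[volume.restrict (Set.Ioo (0 : ℝ) 1)] s}
  zero_mem' := by
    refine ⟨fun _ => 0, ⟨contDiffOn_const, fun i _ => ⟨0, by simp, by simp⟩⟩, ?_⟩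
    rw [map_zero]
    exact Lp.coeFn_zero _ _ _
  add_mem' := by
    rintro a b ⟨s, ⟨hs1, hs2⟩, hs⟩ ⟨t, ⟨ht1, ht2⟩, ht⟩
    refine ⟨fun x => s x + t x, ⟨hs1.add ht1, fun i hi => ?_⟩, ?_⟩
    · obtain ⟨q, hq, hq'⟩ := hs2 i hi
      obtain ⟨r, hr, hr'⟩ := ht2 i hi
      exact ⟨q + r, Polynomial.natDegree_add_le_of_degree_le hq hr, fun x hx => by
        simp only [Polynomial.eval_add]; rw [hq' x hx, hr' x hx]⟩
    · rw [map_add]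
      filter_upwards [Lp.coeFn_add (toL2 a) (toL2 b), hs, ht] with x h1 h2 h3
      rw [h1, Pi.add_apply, h2, h3]
  smul_mem' := by
    rintro c a ⟨s, ⟨hs1, hs2⟩, hs⟩
    refine ⟨fun x => c * s x, ⟨contDiffOn_const.mul hs1, fun i hi => ?_⟩, ?_⟩
    · obtain ⟨q, hq, hq'⟩ := hs2 i hi
      exact ⟨c • q, (Polynomial.natDegree_smul_le _ _).trans hq, fun x hx => by
        simp only [Polynomial.eval_smul, smul_eq_mul]; rw [hq' x hx]⟩
    · rw [map_smul]
      filter_upwards [Lp.coeFn_smul c (toL2 a), hs] with x h1 h2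
      rw [h1, Pi.smul_apply, h2, smul_eq_mul]

/-- The weak derivative is unique, so an element of `H¹` is determined by its function. -/
lemma toL2_injective : Function.Injective toL2 := by
  rw [← LinearMap.ker_eq_bot, LinearMap.ker_eq_bot']
  intro u hu
  have hu1 : (u : WithLp 2 (L2 × L2)).fst = 0 := hu
  have hw : IsWeakDeriv (u : WithLp 2 (L2 × L2)).fst (u : WithLp 2 (L2 × L2)).snd := u.2
  rw [hu1] at hw
  have hu2 : (u : WithLp 2 (L2 × L2)).snd = 0 := by
    set v := (u : WithLp 2 (L2 × L2)).snd
    have hloc : LocallyIntegrableOn v (Set.Ioo (0 : ℝ) 1) := by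
      apply IntegrableOn.locallyIntegrableOn
      exact (Lp.memLp v).integrable (by norm_num)
    have h := isOpen_Ioo.ae_eq_zero_of_integral_contDiff_smul_eq_zero hloc (by
      intro g hg hgc hgs
      have h1 := hw g hg hgc hgs
      have h2 : ∫ x in Set.Ioo (0 : ℝ) 1, (0 : L2) x * deriv g x = 0 := by
        refine integral_eq_zero_of_ae ?_
        filter_upwards [Lp.coeFn_zero ℝ 2 (volume.restrict (Set.Ioo (0 : ℝ) 1))] with x hx
        change (0 : L2) x * deriv g x = 0
        rw [hx, Pi.zero_apply, zero_mul]
      rw [h2] at h1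
      have h3 : ∫ x, g x • v x = ∫ x in Set.Ioo (0 : ℝ) 1, g x • v x := by
        symm
        apply setIntegral_eq_integral_of_forall_compl_eq_zero
        intro x hx
        have : g x = 0 := by
          by_contra hne
          exact hx (hgs (subset_tsupport g hne))
        simp [this]
      rw [h3]
      have h4 : ∫ x in Set.Ioo (0 : ℝ) 1, v x * g x = 0 := by linarith
      refine Eq.trans (integral_congr_ae (Filter.Eventually.of_forall fun x => ?_)) h4
      exact mul_comm _ _)
    apply Lp.ext
    refine Filter.EventuallyEq.trans ?_ (Lp.coeFn_zero ℝ 2 _).symm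
    exact (ae_restrict_iff' measurableSet_Ioo).2 h
  apply Subtype.ext
  apply (WithLp.ofLp_injective 2)
  exact Prod.ext hu1 hu2

/-- The index of the grid cell that contains `x`. -/
def cellIndex (n : ℕ) [NeZero n] (x : ℝ) : Fin n := Fin.ofNat n ⌊x * n⌋₊

lemma measurable_piecewise (n : ℕ) [NeZero n] (q : Fin n → Polynomial ℝ) :
    Measurable fun x : ℝ => (q (cellIndex n x)).eval x := by
  have h1 : Measurable (cellIndex n) :=
    (measurable_from_top (f := Fin.ofNat n)).comp
      (Nat.measurable_floor.comp (measurable_id.mul_const _))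
  have h2 : Measurable fun z : ℝ × Fin n => (q z.2).eval z.1 :=
    measurable_from_prod_countable_left fun i => (q i).continuous.measurable
  exact h2.comp (measurable_id.prodMk h1)

/-- The piecewise polynomial function with given pieces, up to equality almost everywhere. -/
def piecewise (n p : ℕ) [NeZero n] :
    (Fin n → Polynomial.degreeLT ℝ (p + 1)) →ₗ[ℝ]
      (ℝ →ₘ[volume.restrict (Set.Ioo (0 : ℝ) 1)] ℝ) where
  toFun q := AEEqFun.mk (fun x => (q (cellIndex n x) : Polynomial ℝ).eval x)
    (measurable_piecewise n fun i => (q i : Polynomial ℝ)).aestronglyMeasurable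
  map_add' q r := by
    rw [AEEqFun.mk_add_mk, AEEqFun.mk_eq_mk]
    exact Filter.Eventually.of_forall fun x => by simp
  map_smul' c q := by
    rw [RingHom.id_apply]
    refine Eq.trans ?_ (AEEqFun.smul_mk c _
      (measurable_piecewise n fun i => (q i : Polynomial ℝ)).aestronglyMeasurable).symm
    rw [AEEqFun.mk_eq_mk]
    exact Filter.Eventually.of_forall fun x => by simp

/-- The space of splines is finite-dimensional; hence orthogonal projections onto it exist. -/
instance (n₀ p ℓ : ℕ) [NeZero n₀] : FiniteDimensional ℝ (splineSpace n₀ p ℓ) := by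
  have hn0 : gridCount n₀ ℓ ≠ 0 := by
    unfold gridCount
    exact mul_ne_zero (NeZero.ne n₀) (by positivity)
  have : NeZero (gridCount n₀ ℓ) := ⟨hn0⟩
  have : FiniteDimensional ℝ (Polynomial.degreeLT ℝ (p + 1)) :=
    (Polynomial.degreeLTEquiv ℝ (p + 1)).symm.finiteDimensional
  have hpos : (0 : ℝ) < gridCount n₀ ℓ := by
    exact_mod_cast Nat.pos_of_ne_zero hn0
  let J : splineSpace n₀ p ℓ →ₗ[ℝ] (ℝ →ₘ[volume.restrict (Set.Ioo (0 : ℝ) 1)] ℝ) :=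
    (Lp.LpSubmodule ℝ ℝ 2 (volume.restrict (Set.Ioo (0 : ℝ) 1))).subtype ∘ₗ toL2 ∘ₗ
      (splineSpace n₀ p ℓ).subtype
  have hJ : Function.Injective J :=
    Subtype.val_injective.comp (toL2_injective.comp Subtype.val_injective)
  have hr : ∀ u, J u ∈ LinearMap.range (piecewise (gridCount n₀ ℓ) p) := by
    rintro ⟨u, s, ⟨-, hs⟩, hus⟩
    choose q hqq using id hs
    refine ⟨fun i => ⟨q i i.2, Polynomial.mem_degreeLT.2 ?_⟩, ?_⟩
    · exact (Polynomial.degree_le_of_natDegree_le (hqq i i.2).1).trans_lt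
        (by exact_mod_cast Nat.lt_succ_self p)
    apply AEEqFun.ext
    refine (AEEqFun.coeFn_mk _ _).trans ?_
    change _ =ᵐ[_] ⇑(toL2 u)
    refine Filter.EventuallyEq.trans ?_ hus.symm
    have hc : (Set.range fun i : ℕ => (i : ℝ) / gridCount n₀ ℓ).Countable :=
      Set.countable_range _
    have hc' := ae_restrict_of_ae (s := Set.Ioo (0 : ℝ) 1) (hc.ae_notMem volume)
    filter_upwards [hc', ae_restrict_mem measurableSet_Ioo] with x hx hx01
    set k := ⌊x * gridCount n₀ ℓ⌋₊ with hk
    have hx0 : 0 ≤ x * gridCount n₀ ℓ := mul_nonneg hx01.1.le hpos.le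
    have hk1 : (k : ℝ) ≤ x * gridCount n₀ ℓ := Nat.floor_le hx0
    have hk2 : x * gridCount n₀ ℓ < k + 1 := Nat.lt_floor_add_one _
    have hk3 : k < gridCount n₀ ℓ := by
      rw [hk, Nat.floor_lt hx0]
      nlinarith [hx01.2]
    have hk4 : (k : ℝ) ≠ x * gridCount n₀ ℓ := by
      intro h
      exact hx ⟨k, by simp only [h]; field_simp⟩
    have hk5 := lt_of_le_of_ne hk1 hk4
    have hidx : ((cellIndex (gridCount n₀ ℓ) x : Fin _) : ℕ) = k := by
      simp only [cellIndex, Fin.val_ofNat]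
      exact Nat.mod_eq_of_lt hk3
    symm
    apply (hqq _ (cellIndex (gridCount n₀ ℓ) x).2).2
    rw [hidx]
    rw [meshSize, mul_one_div, mul_one_div]
    exact ⟨by rwa [div_lt_iff₀ hpos], by rwa [lt_div_iff₀ hpos]⟩
  exact FiniteDimensional.of_injective
    (LinearMap.codRestrict (LinearMap.range (piecewise (gridCount n₀ ℓ) p)) J hr)
    (fun a b h => hJ (show J a = J b by simpa using congrArg Subtype.val h))

/-- The `A`-orthogonal (that is, `H¹`-orthogonal) projector `T_ℓ : H¹(0,1) → S_{p,ℓ}(0,1)`. -/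
def splineProjector (n₀ p ℓ : ℕ) [NeZero n₀] : H1 →L[ℝ] splineSpace n₀ p ℓ :=
  (splineSpace n₀ p ℓ).orthogonalProjectionOnto

end SplineApprox

end

/-! Let `K` be the primitive operator `f ↦ ∫₀ˣ f` on `L²(0,1)`. Integration by parts gives `⟪K f, g⟫
+ ⟪f, K g⟫ = ⟪f, 1⟫⟪g, 1⟫`, so `K` is skew-adjoint up to a rank-one term (`volterra_inner`). If a
subspace `X` contains `1`, that term vanishes on `Xᗮ`, and a bound for `(1 - P_X) K` passes to `K (1
- P_X)` with the same constant (`norm_map_sub_starProjection_le`).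

This yields, in every degree `t`, a spline space `X_t` containing `1` with `‖(1 - P) K‖ ≤ h`
(`exists_spline_subspace`). Piecewise constants serve for `t = 0`. Put `X_{t+1} = ℝ·1 + K X_t`: then
`K f` is at distance at most `‖K (f - P f)‖ ≤ h ‖f‖` from `X_{t+1}`. The constant never grows, hence
the uniformity in `p`.

For the projection error `e`, set `f = e` and `g = e'`. Orthogonality to `1` and to `K σ`, `σ ∈
X_{p-1}`, says that `f ⊥ 1` and that `r = g - K f` is orthogonal to `X_{p-1}`. As `f` is a constant
plus `K g`, `‖f‖² = -⟪K f, g⟫ = -⟪K f, r⟫ - ‖K f‖² ≤ ‖(1 - P) K f‖ ‖r‖ ≤ h ‖f‖ ‖r‖`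
(`norm_toL2_le_of_orthogonal`). This takes the place of a duality argument. -/

noncomputable section

namespace SplineApprox

open Set

/-! ### Primitives of integrable functions on the unit interval -/

/-- The Lebesgue measure on the unit interval. -/
abbrev μI : Measure ℝ := volume.restrict (Ioo (0 : ℝ) 1)

/-- The primitive `x ↦ ∫₀ˣ f` of a function on the unit interval. -/
def prim (f : ℝ → ℝ) (x : ℝ) : ℝ := ∫ t in (0 : ℝ)..x, f t ∂μI

lemma prim_zero (f : ℝ → ℝ) : prim f 0 = 0 := by simp [prim]

lemma prim_congr {f g : ℝ → ℝ} (h : f =ᵐ[μI] g) : prim f = prim g := by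
  funext x
  exact intervalIntegral.integral_congr_ae (h.mono fun t ht _ => ht)

lemma prim_sub_prim {f : ℝ → ℝ} (hf : Integrable f μI) (a b : ℝ) :
    prim f b - prim f a = ∫ t in a..b, f t ∂μI :=
  intervalIntegral.integral_interval_sub_left hf.intervalIntegrable hf.intervalIntegrable

lemma continuous_prim {f : ℝ → ℝ} (hf : Integrable f μI) : Continuous (prim f) :=
  hf.continuous_primitive 0

lemma setIntegral_unit (f : ℝ → ℝ) : ∫ x in Ioo (0 : ℝ) 1, f x = ∫ x in (0 : ℝ)..1, f x := by
  rw [intervalIntegral.integral_of_le zero_le_one, integral_Ioc_eq_integral_Ioo]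

/-- Since `prim` integrates against `μI`, it is defined and continuous on all of `ℝ`; this lemma
leads back to Lebesgue measure inside the unit interval. -/
lemma intervalIntegral_unit {f : ℝ → ℝ} {a b : ℝ} (ha : 0 ≤ a) (hab : a ≤ b) (hb : b ≤ 1) :
    ∫ t in a..b, f t ∂μI = ∫ t in a..b, f t := by
  rw [intervalIntegral.integral_of_le hab, intervalIntegral.integral_of_le hab,
    integral_Ioc_eq_integral_Ioo, integral_Ioc_eq_integral_Ioo,
    Measure.restrict_restrict measurableSet_Ioo,
    inter_eq_self_of_subset_left (Ioo_subset_Ioo ha hb)]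

lemma intervalIntegral_zero_one (f : ℝ → ℝ) :
    ∫ t in (0 : ℝ)..1, f t ∂μI = ∫ t, f t ∂μI := by
  rw [intervalIntegral_unit le_rfl zero_le_one le_rfl, setIntegral_unit]

lemma prim_one (f : ℝ → ℝ) : prim f 1 = ∫ x, f x ∂μI := intervalIntegral_zero_one f

lemma prim_eq {f : ℝ → ℝ} {x : ℝ} (h0 : 0 ≤ x) (h1 : x ≤ 1) : prim f x = ∫ t in (0 : ℝ)..x, f t :=
  intervalIntegral_unit le_rfl h0 h1

lemma intervalIntegrable_unit {f : ℝ → ℝ} (hf : Integrable f μI) :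
    IntervalIntegrable f volume 0 1 :=
  (intervalIntegrable_iff_integrableOn_Ioo_of_le zero_le_one).2 hf

/-- Integration by parts for primitives of integrable functions. -/
lemma integral_prim_mul_add {f g : ℝ → ℝ} (hf : Integrable f μI) (hg : Integrable g μI) :
    ∫ x, (prim f x * g x + f x * prim g x) ∂μI = (∫ x, f x ∂μI) * ∫ x, g x ∂μI := by
  have hf' := intervalIntegrable_unit hf
  have hg' := intervalIntegrable_unit hg
  have h := (hf'.absolutelyContinuousOnInterval_intervalIntegral
    (c := 0) (by simp)).integral_deriv_mul_eq_sub
    (hg'.absolutelyContinuousOnInterval_intervalIntegral (c := 0) (by simp))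
  simp only [intervalIntegral.integral_same, mul_zero, sub_zero] at h
  rw [setIntegral_unit, setIntegral_unit, setIntegral_unit, ← h]
  apply intervalIntegral.integral_congr_ae
  filter_upwards [hf'.ae_hasDerivAt_integral, hg'.ae_hasDerivAt_integral] with x h1 h2 hx
  have hx' : x ∈ uIcc (0 : ℝ) 1 := uIoc_subset_uIcc hx
  have hx2 : x ∈ Icc (0 : ℝ) 1 := by rwa [uIcc_of_le zero_le_one] at hx'
  rw [(h1 hx' 0 (by simp)).deriv, (h2 hx' 0 (by simp)).deriv, prim_eq hx2.1 hx2.2,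
    prim_eq hx2.1 hx2.2]
  ring

/-- The Cauchy–Schwarz inequality for increments of a primitive. -/
lemma sq_prim_sub_le {f : ℝ → ℝ} (hf : MemLp f 2 μI) {a b : ℝ} (ha : 0 ≤ a) (hab : a ≤ b)
    (hb : b ≤ 1) :
    (prim f b - prim f a) ^ 2 ≤ (b - a) * ∫ t in a..b, f t ^ 2 ∂μI := by
  have hi : Integrable f μI := hf.integrable (by norm_num)
  have hi2 : Integrable (fun t => f t ^ 2) μI := hf.integrable_sq
  rw [prim_sub_prim hi]
  rcases hab.eq_or_lt with rfl | hlt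
  · simp
  set m := ∫ t in a..b, f t ∂μI with hm
  set d := b - a with hd
  have hdpos : 0 < d := sub_pos.2 hlt
  -- Scaling by `d` avoids division by the length: the integral equals `d * (d * ∫ f² - m²)`.
  have h0 : 0 ≤ ∫ t in a..b, (d * f t - m) ^ 2 ∂μI :=
    intervalIntegral.integral_nonneg hab fun t _ => sq_nonneg _
  have h1 : ∫ t in a..b, (d * f t - m) ^ 2 ∂μI
      = d ^ 2 * (∫ t in a..b, f t ^ 2 ∂μI) - 2 * d * m * m + d * m ^ 2 := by
    have hc : ∫ _ in a..b, m ^ 2 ∂μI = d * m ^ 2 := by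
      rw [intervalIntegral_unit ha hab hb, intervalIntegral.integral_const, smul_eq_mul]
    have : ∀ t, (d * f t - m) ^ 2 = d ^ 2 * f t ^ 2 - 2 * d * m * f t + m ^ 2 := fun t => by ring
    simp_rw [this]
    rw [intervalIntegral.integral_add, intervalIntegral.integral_sub,
      intervalIntegral.integral_const_mul, intervalIntegral.integral_const_mul, hc]
    · exact (hi2.const_mul _).intervalIntegrable
    · exact (hi.const_mul _).intervalIntegrable
    · exact ((hi2.const_mul _).sub (hi.const_mul _)).intervalIntegrable
    · exact (integrable_const _).intervalIntegrable
  rw [h1] at h0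
  nlinarith [h0, hdpos]

lemma memLp_of_continuous {g : ℝ → ℝ} (hg : Continuous g) : MemLp g 2 μI := by
  obtain ⟨C, hC⟩ := (isCompact_Icc (a := (0 : ℝ)) (b := 1)).exists_bound_of_continuousOn
    hg.continuousOn
  refine MemLp.of_bound hg.aestronglyMeasurable C ?_
  filter_upwards [ae_restrict_mem measurableSet_Ioo] with x hx
  exact hC x (Ioo_subset_Icc_self hx)

/-! ### The Volterra operator on `L²(0,1)` -/

lemma integrable_coe (f : L2) : Integrable f μI := (Lp.memLp f).integrable (by norm_num)

lemma norm_sq_eq (f : L2) : ‖f‖ ^ 2 = ∫ x, f x ^ 2 ∂μI := by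
  rw [← real_inner_self_eq_norm_sq, L2.inner_def]
  refine integral_congr_ae (Filter.Eventually.of_forall fun x => ?_)
  simp [pow_two]

lemma inner_eq (f g : L2) : inner ℝ f g = ∫ x, f x * g x ∂μI := by
  rw [L2.inner_def]
  refine integral_congr_ae (Filter.Eventually.of_forall fun x => ?_)
  simp [mul_comm]

/-- The constant function one. -/
def oneL2 : L2 := (memLp_const (1 : ℝ)).toLp fun _ => (1 : ℝ)

lemma coeFn_oneL2 : oneL2 =ᵐ[μI] fun _ => (1 : ℝ) := MemLp.coeFn_toLp _

lemma inner_oneL2 (f : L2) : inner ℝ f oneL2 = ∫ x, f x ∂μI := by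
  rw [inner_eq]
  refine integral_congr_ae ?_
  filter_upwards [coeFn_oneL2] with x hx
  rw [hx, mul_one]

/-- The Volterra operator `f ↦ ∫₀ˣ f` on `L²(0,1)`. -/
def volterra : L2 →ₗ[ℝ] L2 where
  toFun f := (memLp_of_continuous (continuous_prim (integrable_coe f))).toLp (prim f)
  map_add' f g := by
    rw [← MemLp.toLp_add]
    refine MemLp.toLp_congr _ _ (Filter.Eventually.of_forall fun x => ?_)
    rw [prim_congr (Lp.coeFn_add f g)]
    exact intervalIntegral.integral_add (integrable_coe f).intervalIntegrable
      (integrable_coe g).intervalIntegrable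
  map_smul' c f := by
    rw [RingHom.id_apply, ← MemLp.toLp_const_smul]
    refine MemLp.toLp_congr _ _ (Filter.Eventually.of_forall fun x => ?_)
    rw [prim_congr (Lp.coeFn_smul c f)]
    exact intervalIntegral.integral_const_mul c _

lemma coeFn_volterra (f : L2) : volterra f =ᵐ[μI] prim f :=
  (memLp_of_continuous (continuous_prim (integrable_coe f))).coeFn_toLp

lemma integrable_mul_coe (f g : L2) : Integrable (fun x => f x * g x) μI :=
  (Lp.memLp f).integrable_mul (Lp.memLp g)

/-- Integration by parts: the boundary term at `0` vanishes, and the one at `1` is the product of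
the two means. -/
lemma volterra_inner (f g : L2) :
    inner ℝ (volterra f) g + inner ℝ f (volterra g) = inner ℝ f oneL2 * inner ℝ g oneL2 := by
  rw [inner_oneL2, inner_oneL2, inner_eq, inner_eq,
    ← integral_prim_mul_add (integrable_coe f) (integrable_coe g),
    ← integral_add (integrable_mul_coe _ _) (integrable_mul_coe _ _)]
  refine integral_congr_ae ?_
  filter_upwards [coeFn_volterra f, coeFn_volterra g] with x h1 h2
  rw [h1, h2]

/-- By Cauchy–Schwarz `|∫₀ˣ f|² ≤ x ‖f‖²`, and the interval has measure one. -/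
lemma norm_volterra_le (f : L2) : ‖volterra f‖ ≤ ‖f‖ := by
  refine le_of_sq_le_sq ?_ (norm_nonneg _)
  have hm := Lp.memLp f
  have hi := hm.integrable_sq
  have h : ∫ _x, ‖f‖ ^ 2 ∂μI = ‖f‖ ^ 2 := by simp
  rw [← h, norm_sq_eq (volterra f)]
  refine integral_mono_ae (Lp.memLp _).integrable_sq (integrable_const _) ?_
  filter_upwards [coeFn_volterra f, ae_restrict_mem measurableSet_Ioo] with x h1 hx
  rw [h1]
  have h2 := sq_prim_sub_le hm le_rfl hx.1.le hx.2.le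
  rw [prim_zero, sub_zero, sub_zero] at h2
  refine h2.trans ?_
  rw [norm_sq_eq, ← intervalIntegral_zero_one]
  have h3 : ∫ t in (0 : ℝ)..x, f t ^ 2 ∂μI ≤ ∫ t in (0 : ℝ)..1, f t ^ 2 ∂μI :=
    intervalIntegral.integral_mono_interval le_rfl hx.1.le hx.2.le
      (Filter.Eventually.of_forall fun t => sq_nonneg _) hi.intervalIntegrable
  have h4 : 0 ≤ ∫ t in (0 : ℝ)..x, f t ^ 2 ∂μI :=
    intervalIntegral.integral_nonneg hx.1.le fun t _ => sq_nonneg _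
  nlinarith [hx.1, hx.2]

/-! ### Transferring the bound from `(1 - P) K` to `K (1 - P)` -/

section Hilbert

variable {E : Type*} [NormedAddCommGroup E] [InnerProductSpace ℝ E]

/-- If `K` is skew-adjoint modulo a functional `⟪·, a⟫` with `a ∈ X`, then the norm of
`K ∘ (1 - P_X)` is bounded by that of `(1 - P_X) ∘ K`. -/
lemma norm_map_sub_starProjection_le (X : Submodule ℝ E) [X.HasOrthogonalProjection]
    (K : E →ₗ[ℝ] E) {a : E} (ha : a ∈ X) {C : ℝ} (hC : 0 ≤ C)
    (hK : ∀ f g, inner ℝ (K f) g + inner ℝ f (K g) = inner ℝ f a * inner ℝ g a)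
    (h : ∀ f, ‖K f - X.starProjection (K f)‖ ≤ C * ‖f‖) (f : E) :
    ‖K (f - X.starProjection f)‖ ≤ C * ‖f‖ := by
  set g := f - X.starProjection f with hg
  have hgX : ∀ y ∈ X, inner ℝ g y = 0 := fun y hy => X.starProjection_inner_eq_zero f y hy
  -- The rank-one term drops out because `g ⊥ a`; the projection of `K (K g)` may be subtracted
  -- because `g ⊥ X`.
  have h1 : inner ℝ (K g) (K g) = - inner ℝ g (K (K g) - X.starProjection (K (K g))) := by
    rw [inner_sub_right, hgX _ (X.starProjection_apply_mem _)]
    have := hK g (K g)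
    rw [hgX a ha] at this
    linarith
  have h2 : ‖K g‖ ^ 2 ≤ ‖g‖ * (C * ‖K g‖) := by
    rw [← real_inner_self_eq_norm_sq, h1, ← inner_neg_right]
    refine (real_inner_le_norm _ _).trans ?_
    rw [norm_neg]
    exact mul_le_mul_of_nonneg_left (h _) (norm_nonneg _)
  have h3 : ‖g‖ ≤ ‖f‖ := by
    have := X.starProjection_orthogonal_val f
    rw [hg, ← this]
    exact Xᗮ.norm_starProjection_apply_le f
  rcases (norm_nonneg (K g)).eq_or_lt with h0 | h0
  · rw [← h0]; positivity
  · have : ‖K g‖ ≤ ‖g‖ * C := by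
      refine le_of_mul_le_mul_right ?_ h0
      nlinarith
    nlinarith

end Hilbert

/-! ### Elements of `H¹` as a constant plus a primitive -/

lemma eq_zero_of_tsupport_subset {φ : ℝ → ℝ} (h : tsupport φ ⊆ Ioo (0 : ℝ) 1) {x : ℝ}
    (hx : x ∉ Ioo (0 : ℝ) 1) : φ x = 0 := by
  by_contra hne
  exact hx (h (subset_tsupport φ hne))

lemma prim_deriv {φ : ℝ → ℝ} (h1 : ContDiff ℝ ∞ φ) (h3 : tsupport φ ⊆ Ioo (0 : ℝ) 1) {x : ℝ}
    (hx : x ∈ Icc (0 : ℝ) 1) : prim (deriv φ) x = φ x := by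
  rw [prim_eq hx.1 hx.2, intervalIntegral.integral_deriv_eq_sub
    (fun y _ => (h1.differentiable (by simp)).differentiableAt)
    ((h1.continuous_deriv (by simp)).intervalIntegrable _ _),
    eq_zero_of_tsupport_subset h3 (x := 0) (by simp), sub_zero]

/-- Integration by parts against `deriv φ`, whose mean is zero, so no boundary term is left. -/
lemma isWeakDeriv_volterra (f : L2) : IsWeakDeriv (volterra f) f := by
  intro φ h1 h2 h3
  have hd : Integrable (deriv φ) μI :=
    (memLp_of_continuous (h1.continuous_deriv (by simp))).integrable (by norm_num)
  have h := integral_prim_mul_add (integrable_coe f) hd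
  have h0 : ∫ x, deriv φ x ∂μI = 0 := by
    rw [← prim_one, prim_deriv h1 h3 (by simp), eq_zero_of_tsupport_subset h3 (by simp)]
  rw [h0, mul_zero] at h
  have h4 : Integrable (fun x => volterra f x * deriv φ x) μI :=
    integrable_mul_of_continuous _ (h1.continuous_deriv (by simp)) h2.deriv
  have h5 : Integrable (fun x => f x * φ x) μI :=
    integrable_mul_of_continuous _ h1.continuous h2
  rw [eq_neg_iff_add_eq_zero, ← integral_add h4 h5]
  refine Eq.trans (integral_congr_ae ?_) h
  filter_upwards [coeFn_volterra f, ae_restrict_mem measurableSet_Ioo] with x hx hx01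
  rw [hx, prim_deriv h1 h3 (Ioo_subset_Icc_self hx01)]

/-- The primitive of an `L²` function as an element of `H¹`. -/
def volterraH1 (f : L2) : H1 := ⟨WithLp.toLp 2 (volterra f, f), isWeakDeriv_volterra f⟩

/-- The weak derivative. -/
def derivL2 : H1 →ₗ[ℝ] L2 :=
  WithLp.sndₗ (p := 2) (𝕜 := ℝ) (α := L2) (β := L2) ∘ₗ H1.subtype

@[simp] lemma toL2_volterraH1 (f : L2) : toL2 (volterraH1 f) = volterra f := rfl

@[simp] lemma derivL2_volterraH1 (f : L2) : derivL2 (volterraH1 f) = f := rfl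

lemma inner_H1 (u v : H1) :
    inner ℝ u v = inner ℝ (toL2 u) (toL2 v) + inner ℝ (derivL2 u) (derivL2 v) := by
  rw [Submodule.coe_inner, WithLp.prod_inner_apply]
  rfl

lemma norm_sq_H1 (u : H1) : ‖u‖ ^ 2 = ‖toL2 u‖ ^ 2 + ‖derivL2 u‖ ^ 2 := by
  simp only [← real_inner_self_eq_norm_sq, inner_H1]

/-- A smooth function with support in `(0,1)` and vanishing integral has a primitive with
support in `(0,1)`. -/
lemma exists_primitive_of_integral_eq_zero {θ : ℝ → ℝ} (h1 : ContDiff ℝ ∞ θ)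
    (h2 : HasCompactSupport θ) (h3 : tsupport θ ⊆ Ioo (0 : ℝ) 1)
    (h0 : ∫ x in Ioo (0 : ℝ) 1, θ x = 0) :
    ∃ φ : ℝ → ℝ, ContDiff ℝ ∞ φ ∧ HasCompactSupport φ ∧ tsupport φ ⊆ Ioo (0 : ℝ) 1 ∧
      deriv φ = θ := by
  have hd : ∀ x, HasDerivAt (fun x => ∫ t in (0 : ℝ)..x, θ t) (θ x) x := fun x =>
    intervalIntegral.integral_hasDerivAt_right (h1.continuous.intervalIntegrable _ _)
      (h1.continuous.stronglyMeasurableAtFilter _ _) h1.continuous.continuousAt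
  have hderiv : deriv (fun x => ∫ t in (0 : ℝ)..x, θ t) = θ := funext fun x => (hd x).deriv
  obtain ⟨a, b, ha, hb, hab⟩ : ∃ a b : ℝ, 0 < a ∧ b < 1 ∧ tsupport θ ⊆ Icc a b := by
    rcases (tsupport θ).eq_empty_or_nonempty with he | hne
    -- With empty support, any pair with `b < a` makes the interval empty.
    · exact ⟨1, 0, one_pos, one_pos, by simp [he]⟩
    · obtain ⟨a, ha⟩ := h2.isCompact.exists_isLeast hne
      obtain ⟨b, hb⟩ := h2.isCompact.exists_isGreatest hne
      exact ⟨a, b, (h3 ha.1).1, (h3 hb.1).2, fun x hx => ⟨ha.2 hx, hb.2 hx⟩⟩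
  have hθ : ∀ x, x ∉ Icc a b → θ x = 0 := fun x hx => by
    by_contra hne
    exact hx (hab (subset_tsupport θ hne))
  have hs : tsupport (fun x => ∫ t in (0 : ℝ)..x, θ t) ⊆ Icc a b := by
    refine closure_minimal (fun x hx => ?_) isClosed_Icc
    by_contra hxab
    apply hx
    change ∫ t in (0 : ℝ)..x, θ t = 0
    rcases lt_or_ge x a with hxa | hxa
    · rw [intervalIntegral.integral_congr (g := fun _ => (0 : ℝ)), intervalIntegral.integral_zero]
      intro t ht
      refine hθ t fun htab => ?_
      rcases mem_uIcc.1 ht with h | h <;> linarith [htab.1, h.2]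
    -- To the right of the support the primitive equals the total integral, which is zero.
    · have hxb : b < x := not_le.1 fun h => hxab ⟨hxa, h⟩
      rw [setIntegral_unit] at h0
      rw [← intervalIntegral.integral_add_adjacent_intervals (b := 1)
        (h1.continuous.intervalIntegrable _ _) (h1.continuous.intervalIntegrable _ _), h0, zero_add,
        intervalIntegral.integral_congr (g := fun _ => (0 : ℝ)), intervalIntegral.integral_zero]
      intro t ht
      refine hθ t fun htab => ?_
      rcases mem_uIcc.1 ht with h | h <;> linarith [htab.2, h.1]
  refine ⟨_, contDiff_infty_iff_deriv.2 ⟨fun x => (hd x).differentiableAt, ?_⟩,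
    isCompact_Icc.of_isClosed_subset (isClosed_tsupport _) hs,
    hs.trans fun x hx => ⟨ha.trans_le hx.1, hx.2.trans_lt hb⟩, hderiv⟩
  rw [hderiv]
  exact h1

lemma exists_bump : ∃ η : ℝ → ℝ, ContDiff ℝ ∞ η ∧ HasCompactSupport η ∧
    tsupport η ⊆ Ioo (0 : ℝ) 1 ∧ ∫ x in Ioo (0 : ℝ) 1, η x = 1 := by
  let B : ContDiffBump (1 / 2 : ℝ) := ⟨1 / 8, 1 / 4, by norm_num, by norm_num⟩
  have hs : tsupport (B.normed volume) ⊆ Ioo (0 : ℝ) 1 := by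
    rw [B.tsupport_normed_eq, Real.closedBall_eq_Icc]
    intro x hx
    have h4 : B.rOut = 1 / 4 := rfl
    rw [h4] at hx
    constructor <;> linarith [hx.1, hx.2]
  refine ⟨B.normed volume, B.contDiff_normed, B.hasCompactSupport_normed, hs, ?_⟩
  rw [setIntegral_eq_integral_of_forall_compl_eq_zero
    fun x hx => eq_zero_of_tsupport_subset hs hx]
  exact B.integral_normed

/-- The lemma of du Bois-Reymond: a function with vanishing weak derivative is constant. -/
lemma eq_const_of_isWeakDeriv_zero {z : L2} (hz : IsWeakDeriv z 0) : ∃ a : ℝ, z = a • oneL2 := by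
  obtain ⟨η, hη1, hη2, hη3, hη⟩ := exists_bump
  set A := ∫ x in Ioo (0 : ℝ) 1, z x * η x with hA
  refine ⟨A, ?_⟩
  have hzi : Integrable (fun x => z x - A) μI := (integrable_coe z).sub (integrable_const _)
  have h := isOpen_Ioo.ae_eq_zero_of_integral_contDiff_smul_eq_zero (U := Ioo (0 : ℝ) 1)
    (f := fun x => z x - A) (μ := volume) (IntegrableOn.locallyIntegrableOn hzi) (by
      intro ψ hψ1 hψ2 hψ3
      have hψi : Integrable ψ μI :=
        (memLp_of_continuous hψ1.continuous).integrable (by norm_num)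
      have hηi : Integrable η μI :=
        (memLp_of_continuous hη1.continuous).integrable (by norm_num)
      set m := ∫ x in Ioo (0 : ℝ) 1, ψ x with hm
      have hzψ := integrable_mul_of_continuous z hψ1.continuous hψ2
      have hzη := integrable_mul_of_continuous z hη1.continuous hη2
      have hcs : HasCompactSupport fun x => ψ x - m * η x := hψ2.sub (hη2.mul_left)
      have hts : tsupport (fun x => ψ x - m * η x) ⊆ Ioo (0 : ℝ) 1 := by
        refine (closure_minimal ?_ ((isClosed_tsupport ψ).union (isClosed_tsupport η))).trans
          (union_subset hψ3 hη3)
        intro x hx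
        by_contra hn
        rw [mem_union, not_or] at hn
        apply hx
        simp only [image_eq_zero_of_notMem_tsupport hn.1, image_eq_zero_of_notMem_tsupport hn.2,
          mul_zero, sub_zero]
      -- Subtracting `m * η` makes the mean zero, so the difference is the derivative of a test
      -- function, and testing `z` with it gives `∫ z ψ = A * ∫ ψ`.
      obtain ⟨φ, hφ1, hφ2, hφ3, hφ⟩ := exists_primitive_of_integral_eq_zero
        (θ := fun x => ψ x - m * η x) (hψ1.sub (contDiff_const.mul hη1)) hcs hts (by
          rw [integral_sub hψi (hηi.const_mul _), integral_const_mul, hη, ← hm]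
          ring)
      have h1 := hz φ hφ1 hφ2 hφ3
      have h2 : ∫ x in Ioo (0 : ℝ) 1, (0 : L2) x * φ x = 0 := by
        refine integral_eq_zero_of_ae ?_
        filter_upwards [Lp.coeFn_zero ℝ 2 μI] with x hx
        change (0 : L2) x * φ x = 0
        rw [hx, Pi.zero_apply, zero_mul]
      have h3 : ∀ x, z x * deriv φ x = z x * ψ x - m * (z x * η x) := fun x => by
        rw [hφ]; ring
      rw [h2, neg_zero] at h1
      simp_rw [h3] at h1
      rw [integral_sub hzψ (hzη.const_mul _), integral_const_mul, ← hA] at h1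
      rw [← setIntegral_eq_integral_of_forall_compl_eq_zero (s := Ioo (0 : ℝ) 1)
        fun x hx => by rw [eq_zero_of_tsupport_subset hψ3 hx, zero_smul]]
      have h4 : ∀ x, ψ x • (z x - A) = z x * ψ x - A * ψ x := fun x => by
        rw [smul_eq_mul]; ring
      simp_rw [h4]
      rw [integral_sub hzψ (hψi.const_mul _), integral_const_mul, ← hm]
      linarith)
  apply Lp.ext
  filter_upwards [(ae_restrict_iff' measurableSet_Ioo).2 h, Lp.coeFn_smul A oneL2,
    coeFn_oneL2] with x h1 h2 h3
  rw [h2, Pi.smul_apply, h3, smul_eq_mul, mul_one]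
  linarith

/-- Subtracting the primitive of the weak derivative leaves a function with weak derivative zero. -/
lemma exists_eq_const_add_volterra (u : H1) :
    ∃ a : ℝ, toL2 u = a • oneL2 + volterra (derivL2 u) := by
  have h := (u - volterraH1 (derivL2 u)).2
  have h0 : derivL2 (u - volterraH1 (derivL2 u)) = 0 := by simp
  have h' : IsWeakDeriv (toL2 (u - volterraH1 (derivL2 u)))
    (derivL2 (u - volterraH1 (derivL2 u))) := h
  rw [h0] at h'
  obtain ⟨a, ha⟩ := eq_const_of_isWeakDeriv_zero h'
  refine ⟨a, ?_⟩
  rw [← ha, map_sub, toL2_volterraH1, sub_add_cancel]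

lemma isWeakDeriv_oneL2 : IsWeakDeriv oneL2 0 := by
  intro φ h1 _ h3
  have h0 : ∫ x, deriv φ x ∂μI = 0 := by
    rw [← prim_one, prim_deriv h1 h3 (by simp), eq_zero_of_tsupport_subset h3 (by simp)]
  rw [integral_congr_ae (g := deriv φ), h0, eq_comm, neg_eq_zero]
  · refine integral_eq_zero_of_ae ?_
    filter_upwards [Lp.coeFn_zero ℝ 2 μI] with x hx
    change (0 : L2) x * φ x = 0
    rw [hx, Pi.zero_apply, zero_mul]
  · filter_upwards [coeFn_oneL2] with x hx
    rw [hx, one_mul]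

/-- The constant function one as an element of `H¹`. -/
def oneH1 : H1 := ⟨WithLp.toLp 2 (oneL2, 0), isWeakDeriv_oneL2⟩

@[simp] lemma toL2_oneH1 : toL2 oneH1 = oneL2 := rfl

@[simp] lemma derivL2_oneH1 : derivL2 oneH1 = 0 := rfl

/-! ### Spline spaces in `L²` and their primitives -/

lemma exists_polynomial_antiderivative (q : Polynomial ℝ) :
    ∃ Q : Polynomial ℝ, Q.natDegree ≤ q.natDegree + 1 ∧ Q.derivative = q := by
  refine ⟨∑ i ∈ Finset.range (q.natDegree + 1),
    Polynomial.monomial (i + 1) (q.coeff i / ((i : ℝ) + 1)), ?_, ?_⟩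
  · refine Polynomial.natDegree_sum_le_of_forall_le _ _ fun i hi => ?_
    have := Finset.mem_range.1 hi
    exact (Polynomial.natDegree_monomial_le _).trans (by omega)
  · rw [Polynomial.derivative_sum]
    conv_rhs => rw [q.as_sum_range]
    refine Finset.sum_congr rfl fun i _ => ?_
    rw [Polynomial.derivative_monomial, Nat.add_sub_cancel]
    congr 1
    push_cast
    field_simp

/-- The splines of degree `t` and smoothness `C^{t-1}` over the uniform grid with `n` cells,
as a subspace of `L²(0,1)`. -/
def splinesL2 (n t : ℕ) : Submodule ℝ L2 where
  -- Quantifying over `m < t` imposes no smoothness for `t = 0`, which admits discontinuous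
  -- piecewise constants.
  carrier := {f | ∃ s : ℝ → ℝ, (∀ m < t, ContDiffOn ℝ (m : ℕ∞) s (Ioo 0 1)) ∧
    (∀ i < n, ∃ q : Polynomial ℝ, q.natDegree ≤ t ∧
      ∀ x ∈ Ioo ((i : ℝ) / n) (((i : ℝ) + 1) / n), s x = q.eval x) ∧ f =ᵐ[μI] s}
  zero_mem' := ⟨fun _ => 0, fun _ _ => contDiffOn_const, fun _ _ => ⟨0, by simp, by simp⟩,
    Lp.coeFn_zero _ _ _⟩
  add_mem' := by
    rintro a b ⟨s, hs1, hs2, hs⟩ ⟨r, hr1, hr2, hr⟩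
    refine ⟨fun x => s x + r x, fun m hm => (hs1 m hm).add (hr1 m hm), fun i hi => ?_, ?_⟩
    · obtain ⟨q, hq, hq'⟩ := hs2 i hi
      obtain ⟨q2, hq2, hq2'⟩ := hr2 i hi
      refine ⟨q + q2, Polynomial.natDegree_add_le_of_degree_le hq hq2, fun x hx => ?_⟩
      simp only [Polynomial.eval_add]
      rw [hq' x hx, hq2' x hx]
    · filter_upwards [Lp.coeFn_add a b, hs, hr] with x h1 h2 h3
      rw [h1, Pi.add_apply, h2, h3]
  smul_mem' := by
    rintro c a ⟨s, hs1, hs2, hs⟩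
    refine ⟨fun x => c * s x, fun m hm => contDiffOn_const.mul (hs1 m hm), fun i hi => ?_, ?_⟩
    · obtain ⟨q, hq, hq'⟩ := hs2 i hi
      refine ⟨c • q, (Polynomial.natDegree_smul_le _ _).trans hq, fun x hx => ?_⟩
      simp only [Polynomial.eval_smul, smul_eq_mul]
      rw [hq' x hx]
    · filter_upwards [Lp.coeFn_smul c a, hs] with x h1 h2
      rw [h1, Pi.smul_apply, h2, smul_eq_mul]

lemma oneL2_mem_splinesL2 (n t : ℕ) : oneL2 ∈ splinesL2 n t :=
  ⟨fun _ => 1, fun _ _ => contDiffOn_const, fun _ _ => ⟨1, by simp, by simp⟩, coeFn_oneL2⟩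

lemma grid_nonneg (n i : ℕ) : (0 : ℝ) ≤ (i : ℝ) / n := by positivity

lemma grid_le (n i : ℕ) : (i : ℝ) / n ≤ ((i : ℝ) + 1) / n := by
  gcongr
  linarith

lemma grid_le_one {n i : ℕ} (hi : i < n) : ((i : ℝ) + 1) / n ≤ 1 := by
  rw [div_le_one (by exact_mod_cast (Nat.zero_le i).trans_lt hi)]
  exact_mod_cast hi

/-- The Volterra operator maps splines to splines of the next degree. -/
lemma volterra_mem_splinesL2 {n t : ℕ} {f : L2} (hf : f ∈ splinesL2 n t) :
    volterra f ∈ splinesL2 n (t + 1) := by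
  obtain ⟨s, hs1, hs2, hs⟩ := hf
  have hsi : Integrable s μI := (integrable_congr hs).1 (integrable_coe f)
  have hprim : prim f = prim s := prim_congr hs
  refine ⟨prim f, fun m hm => ?_, fun i hi => ?_, coeFn_volterra f⟩
  · rw [hprim]
    cases m with
    -- Continuity has to come from integrability alone, since for `t = 0` the spline `s` may jump.
    | zero => exact contDiffOn_zero.2 (continuous_prim hsi).continuousOn
    | succ m =>
      have hmt : m < t := by omega
      have hsc : ContinuousOn s (Ioo 0 1) := (hs1 m hmt).continuousOn
      have hd : ∀ x ∈ Ioo (0 : ℝ) 1, HasDerivAt (prim s) (s x) x := by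
        intro x hx
        have h1 : HasDerivAt (fun y => ∫ t in (0 : ℝ)..y, s t) (s x) x := by
          refine intervalIntegral.integral_hasDerivAt_right
            ((intervalIntegrable_unit hsi).mono_set ?_)
            (hsc.stronglyMeasurableAtFilter isOpen_Ioo x hx)
            (hsc.continuousAt (isOpen_Ioo.mem_nhds hx))
          rw [uIcc_of_le hx.1.le, uIcc_of_le zero_le_one]
          exact Icc_subset_Icc_right hx.2.le
        refine h1.congr_of_eventuallyEq ?_
        filter_upwards [isOpen_Ioo.mem_nhds hx] with y hy
        exact prim_eq hy.1.le hy.2.le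
      have : ((m + 1 : ℕ) : ℕ∞) = (m : ℕ∞) + 1 := by push_cast; rfl
      rw [this]
      push_cast
      rw [contDiffOn_succ_iff_deriv_of_isOpen isOpen_Ioo]
      refine ⟨fun x hx => (hd x hx).differentiableAt.differentiableWithinAt, by simp, ?_⟩
      exact (hs1 m hmt).congr fun x hx => (hd x hx).deriv
  · obtain ⟨q, hq, hq'⟩ := hs2 i hi
    obtain ⟨Q, hQ, rfl⟩ := exists_polynomial_antiderivative q
    -- The constant matches the value of the primitive at the left end of the cell.
    refine ⟨Q + Polynomial.C (prim f (i / n) - Q.eval ((i : ℝ) / n)), ?_, fun x hx => ?_⟩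
    · rw [Polynomial.natDegree_add_C]
      omega
    · have h0 := grid_nonneg n i
      have h1 := grid_le_one hi
      have h2 : prim s x - prim s (i / n) = Q.eval x - Q.eval ((i : ℝ) / n) := by
        rw [prim_sub_prim hsi, intervalIntegral_unit h0 hx.1.le (hx.2.le.trans h1),
          ← intervalIntegral.integral_eq_sub_of_hasDerivAt (f := fun x => Q.eval x)
          (fun y _ => Q.hasDerivAt y) (Q.derivative.continuous.intervalIntegrable _ _)]
        rw [intervalIntegral.integral_of_le hx.1.le, intervalIntegral.integral_of_le hx.1.le,
          integral_Ioc_eq_integral_Ioo, integral_Ioc_eq_integral_Ioo]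
        exact setIntegral_congr_fun measurableSet_Ioo fun y hy => hq' y ⟨hy.1, hy.2.trans hx.2⟩
      rw [Polynomial.eval_add, Polynomial.eval_C, hprim]
      linarith

/-! ### Approximation by piecewise constants -/

/-- The characteristic function of a grid cell. -/
def cellIndicator (n i : ℕ) : L2 :=
  indicatorConstLp 2 (measurableSet_Ioo (a := (i : ℝ) / n) (b := ((i : ℝ) + 1) / n))
    (measure_ne_top μI _) (1 : ℝ)

lemma coeFn_cellIndicator (n i : ℕ) : cellIndicator n i =ᵐ[μI]
    (Ioo ((i : ℝ) / n) (((i : ℝ) + 1) / n)).indicator fun _ => (1 : ℝ) :=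
  indicatorConstLp_coeFn

lemma disjoint_cells {n i j : ℕ} (hij : i ≠ j) :
    Disjoint (Ioo ((i : ℝ) / n) (((i : ℝ) + 1) / n)) (Ioo ((j : ℝ) / n) (((j : ℝ) + 1) / n)) := by
  wlog h : i < j generalizing i j
  · exact (this hij.symm (by omega)).symm
  rw [Set.disjoint_left]
  intro x hx hy
  have : ((i : ℝ) + 1) / n ≤ (j : ℝ) / n := by
    gcongr
    exact_mod_cast h
  linarith [hx.2, hy.1]

lemma cellIndicator_mem_splinesL2 (n i : ℕ) : cellIndicator n i ∈ splinesL2 n 0 := by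
  refine ⟨_, fun m hm => absurd hm (Nat.not_lt_zero m), fun j _ => ?_, coeFn_cellIndicator n i⟩
  rcases eq_or_ne i j with rfl | hij
  · exact ⟨1, by simp, fun x hx => by rw [indicator_of_mem hx, Polynomial.eval_one]⟩
  · refine ⟨0, by simp, fun x hx => ?_⟩
    rw [indicator_of_notMem ((disjoint_cells hij).notMem_of_mem_right hx), Polynomial.eval_zero]

/-- The piecewise constant function with value `c i` on the `i`-th cell. -/
def cellSum (n : ℕ) (c : ℕ → ℝ) : L2 := ∑ i ∈ Finset.range n, c i • cellIndicator n i

lemma cellSum_ae (n : ℕ) (c : ℕ → ℝ) : ∀ᵐ x ∂μI, ∀ i < n,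
    x ∈ Ioo ((i : ℝ) / n) (((i : ℝ) + 1) / n) → cellSum n c x = c i := by
  have h1 : cellSum n c =ᵐ[μI] ∑ i ∈ Finset.range n, ⇑(c i • cellIndicator n i) := by
    unfold cellSum
    exact Lp.coeFn_finsetSum _ _
  have h2 := ae_all_iff.2 fun i => Lp.coeFn_smul (c i) (cellIndicator n i)
  have h3 := ae_all_iff.2 fun i => coeFn_cellIndicator n i
  filter_upwards [h1, h2, h3] with x hx1 hx2 hx3 i hi hx
  rw [hx1, Finset.sum_apply, Finset.sum_eq_single i]
  · rw [hx2, Pi.smul_apply, hx3, indicator_of_mem hx, smul_eq_mul, mul_one]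
  · intro j _ hji
    rw [hx2, Pi.smul_apply, hx3,
      indicator_of_notMem ((disjoint_cells hji).notMem_of_mem_right hx), smul_zero]
  · intro h
    exact absurd (Finset.mem_range.2 hi) h

lemma sum_cells {n : ℕ} (hn : 0 < n) {g : ℝ → ℝ} (hg : Integrable g μI) :
    ∑ i ∈ Finset.range n, ∫ x in ((i : ℝ) / n)..(((i : ℝ) + 1) / n), g x ∂μI = ∫ x, g x ∂μI := by
  have h := intervalIntegral.sum_integral_adjacent_intervals (f := g) (μ := μI)
    (a := fun i : ℕ => (i : ℝ) / n) (n := n) fun _ _ => hg.intervalIntegrable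
  have hn' : (n : ℝ) ≠ 0 := by positivity
  simp only [Nat.cast_add, Nat.cast_one, Nat.cast_zero, zero_div, div_self hn'] at h
  rw [h, intervalIntegral_zero_one]

/-- Bounds on all cells add up to a bound on the unit interval. -/
lemma norm_sq_le_of_cells {n : ℕ} (hn : 0 < n) {f g : L2} {C : ℝ}
    (h : ∀ i < n, ∫ x in ((i : ℝ) / n)..(((i : ℝ) + 1) / n), g x ^ 2 ∂μI ≤
      C * ∫ x in ((i : ℝ) / n)..(((i : ℝ) + 1) / n), f x ^ 2 ∂μI) : ‖g‖ ^ 2 ≤ C * ‖f‖ ^ 2 := by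
  rw [norm_sq_eq, norm_sq_eq, ← sum_cells hn (Lp.memLp f).integrable_sq,
    ← sum_cells hn (Lp.memLp g).integrable_sq, Finset.mul_sum]
  exact Finset.sum_le_sum fun i hi => h i (Finset.mem_range.1 hi)

lemma integral_cell_congr {n : ℕ} (i : ℕ) {g k : ℝ → ℝ}
    (h : ∀ᵐ x ∂μI, x ∈ Ioo ((i : ℝ) / n) (((i : ℝ) + 1) / n) → g x = k x) :
    ∫ x in ((i : ℝ) / n)..(((i : ℝ) + 1) / n), g x ∂μI =
      ∫ x in ((i : ℝ) / n)..(((i : ℝ) + 1) / n), k x ∂μI := by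
  rw [intervalIntegral.integral_of_le (grid_le n i), intervalIntegral.integral_of_le (grid_le n i),
    integral_Ioc_eq_integral_Ioo, integral_Ioc_eq_integral_Ioo]
  exact setIntegral_congr_ae measurableSet_Ioo h

/-- The two functions may differ at grid points, so equality is obtained from a vanishing norm, cell
by cell. -/
lemma cellSum_one {n : ℕ} (hn : 0 < n) : cellSum n (fun _ => 1) = oneL2 := by
  rw [← sub_eq_zero, ← norm_eq_zero, ← sq_eq_zero_iff]
  refine le_antisymm ?_ (sq_nonneg _)
  have := norm_sq_le_of_cells hn (f := 0) (g := cellSum n (fun _ => 1) - oneL2) (C := 0) ?_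
  · simpa using this
  intro i hi
  rw [zero_mul, integral_cell_congr i (k := fun _ => 0), intervalIntegral.integral_zero]
  filter_upwards [cellSum_ae n fun _ => 1, coeFn_oneL2,
    Lp.coeFn_sub (cellSum n fun _ => 1) oneL2] with x h1 h2 h3 hx
  rw [h3, Pi.sub_apply, h1 i hi hx, h2]
  simp

/-- Piecewise constant interpolation of a primitive is first order accurate. -/
lemma norm_volterra_sub_cellSum_le {n : ℕ} (hn : 0 < n) (f : L2) :
    ‖volterra f - cellSum n fun i => prim f (i / n)‖ ≤ 1 / n * ‖f‖ := by
  refine le_of_sq_le_sq ?_ (by positivity)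
  rw [mul_pow]
  refine norm_sq_le_of_cells hn fun i hi => ?_
  have hm := Lp.memLp f
  have h0 := grid_nonneg n i
  have h01 := grid_le n i
  have h1 := grid_le_one hi
  have hlen : ((i : ℝ) + 1) / n - (i : ℝ) / n = 1 / n := by ring
  set I := ∫ x in ((i : ℝ) / n)..(((i : ℝ) + 1) / n), f x ^ 2 ∂μI with hI
  rw [integral_cell_congr i (k := fun x => (prim f x - prim f (i / n)) ^ 2)]
  · have hc := continuous_prim (integrable_coe f)
    -- One factor `1 / n` comes from Cauchy–Schwarz on the cell; integrating the constant bound over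
    -- the cell supplies the second.
    have hb : ∀ x ∈ Icc ((i : ℝ) / n) (((i : ℝ) + 1) / n),
        (prim f x - prim f (i / n)) ^ 2 ≤ 1 / n * I := by
      intro x hx
      refine (sq_prim_sub_le hm h0 hx.1 (hx.2.trans h1)).trans ?_
      have hnn : 0 ≤ ∫ t in ((i : ℝ) / n)..x, f t ^ 2 ∂μI :=
        intervalIntegral.integral_nonneg hx.1 fun t _ => sq_nonneg _
      have hmono : ∫ t in ((i : ℝ) / n)..x, f t ^ 2 ∂μI ≤ I :=
        intervalIntegral.integral_mono_interval le_rfl hx.1 hx.2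
          (Filter.Eventually.of_forall fun t => sq_nonneg _) hm.integrable_sq.intervalIntegrable
      exact mul_le_mul (by linarith [hx.2]) hmono hnn (by positivity)
    have hint : IntervalIntegrable (fun x => (prim f x - prim f (i / n)) ^ 2) μI
        ((i : ℝ) / n) (((i : ℝ) + 1) / n) :=
      ((hc.sub continuous_const).pow 2).intervalIntegrable _ _
    refine (intervalIntegral.integral_mono_on h01 hint
      (integrable_const (1 / n * I)).intervalIntegrable hb).trans ?_
    rw [intervalIntegral_unit h0 h01 h1, intervalIntegral.integral_const, hlen, smul_eq_mul]
    exact le_of_eq (by ring)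
  · filter_upwards [cellSum_ae n fun i => prim f (i / n), coeFn_volterra f,
      Lp.coeFn_sub (volterra f) (cellSum n fun i => prim f (i / n))] with x h1 h2 h3 hx
    rw [h3, Pi.sub_apply, h1 i hi hx, h2]

/-! ### Approximation in every degree, uniformly in the degree -/

lemma norm_sub_starProjection_le {E : Type*} [NormedAddCommGroup E] [InnerProductSpace ℝ E]
    (X : Submodule ℝ E) [X.HasOrthogonalProjection] (f : E) {y : E} (hy : y ∈ X) :
    ‖f - X.starProjection f‖ ≤ ‖f - y‖ := by
  have h : f - X.starProjection f = (f - y) - X.starProjection (f - y) := by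
    rw [map_sub, X.starProjection_eq_self_iff.2 hy]
    abel
  rw [h, ← X.starProjection_orthogonal_val]
  exact Xᗮ.norm_starProjection_apply_le _

/-- In every degree there is a finite-dimensional space of splines that approximates primitives
with first order, uniformly in the degree. -/
lemma exists_spline_subspace {n : ℕ} (hn : 0 < n) (t : ℕ) :
    ∃ X : Submodule ℝ L2, ∃ _ : FiniteDimensional ℝ X, X ≤ splinesL2 n t ∧ oneL2 ∈ X ∧
      ∀ f, ‖volterra f - X.starProjection (volterra f)‖ ≤ 1 / n * ‖f‖ := by
  induction t with
  | zero =>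
    let X : Submodule ℝ L2 := Submodule.span ℝ (cellIndicator n '' (Finset.range n : Set ℕ))
    have hfd : FiniteDimensional ℝ X :=
      FiniteDimensional.span_of_finite ℝ ((Finset.finite_toSet _).image _)
    have hX : ∀ c, cellSum n c ∈ X := fun c => Submodule.sum_mem _ fun i hi =>
      X.smul_mem _ (Submodule.subset_span ⟨i, hi, rfl⟩)
    refine ⟨X, hfd, ?_, ?_, fun f => ?_⟩
    · rw [Submodule.span_le]
      rintro _ ⟨i, -, rfl⟩
      exact cellIndicator_mem_splinesL2 n i
    · rw [← cellSum_one hn]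
      exact hX _
    · exact (norm_sub_starProjection_le X _ (hX _)).trans (norm_volterra_sub_cellSum_le hn f)
  | succ t ih =>
    obtain ⟨X, hfd, hX, h1, h⟩ := ih
    -- The constants are adjoined so that `1` lies in the new space, as the next induction step
    -- requires.
    refine ⟨Submodule.span ℝ {oneL2} ⊔ X.map volterra, inferInstance, ?_, ?_, fun f => ?_⟩
    · refine sup_le ?_ ?_
      · rw [Submodule.span_singleton_le_iff_mem]
        exact oneL2_mem_splinesL2 n _
      · rintro _ ⟨g, hg, rfl⟩
        exact volterra_mem_splinesL2 (hX hg)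
    · exact Submodule.mem_sup_left (Submodule.mem_span_singleton_self _)
    -- The competitor `K (P f)` turns the error into `K (f - P f)`, to which the transfer lemma
    -- applies.
    · refine (norm_sub_starProjection_le _ _ (y := volterra (X.starProjection f))
        (Submodule.mem_sup_right (Submodule.mem_map_of_mem (X.starProjection_apply_mem f)))).trans ?_
      rw [← map_sub]
      exact norm_map_sub_starProjection_le X volterra h1 (by positivity) volterra_inner h f

/-! ### From approximation of primitives to the projection error -/

lemma mem_splineSpace {n₀ p ℓ : ℕ} (hp : 1 ≤ p) {u : H1}
    (hu : toL2 u ∈ splinesL2 (gridCount n₀ ℓ) p) : u ∈ splineSpace n₀ p ℓ := by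
  obtain ⟨s, hs1, hs2, hs⟩ := hu
  refine ⟨s, ⟨hs1 (p - 1) (by omega), fun i hi => ?_⟩, hs⟩
  obtain ⟨q, hq, hq'⟩ := hs2 i hi
  refine ⟨q, hq, fun x hx => hq' x ?_⟩
  rwa [meshSize, mul_one_div, mul_one_div] at hx

/-- A function that is `H¹`-orthogonal to all primitives of a space `X` of approximants and to
the constants is small in `L²`. -/
lemma norm_toL2_le_of_orthogonal (X : Submodule ℝ L2) [X.HasOrthogonalProjection] {h : ℝ}
    (hh : 0 ≤ h) (hX : ∀ f, ‖volterra f - X.starProjection (volterra f)‖ ≤ h * ‖f‖) {e : H1}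
    (h1 : inner ℝ e oneH1 = 0) (h2 : ∀ σ ∈ X, inner ℝ e (volterraH1 σ) = 0) :
    ‖toL2 e‖ ≤ h * (‖derivL2 e‖ + ‖toL2 e‖) := by
  set f := toL2 e with hf
  set g := derivL2 e with hg
  have hf1 : inner ℝ f oneL2 = 0 := by
    rwa [inner_H1, toL2_oneH1, derivL2_oneH1, inner_zero_right, add_zero] at h1
  set r := g - volterra f with hr
  have hskew : ∀ k, inner ℝ f (volterra k) = - inner ℝ (volterra f) k := fun k => by
    have := volterra_inner f k
    rw [hf1, zero_mul] at this
    linarith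
  -- Moving `K` from `σ` to `f` turns `⟪f, K σ⟫ + ⟪g, σ⟫ = 0` into `⟪g - K f, σ⟫ = 0`.
  have hrX : ∀ σ ∈ X, inner ℝ σ r = 0 := by
    intro σ hσ
    have := h2 σ hσ
    rw [inner_H1, toL2_volterraH1, derivL2_volterraH1, hskew] at this
    rw [real_inner_comm, hr, inner_sub_left]
    linarith
  obtain ⟨a, ha⟩ := exists_eq_const_add_volterra e
  have hsq : ‖f‖ ^ 2 ≤ h * ‖f‖ * ‖r‖ := by
    calc ‖f‖ ^ 2 = inner ℝ f (a • oneL2 + volterra g) := by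
          rw [← ha, real_inner_self_eq_norm_sq]
      _ = - inner ℝ (volterra f) g := by
          rw [inner_add_right, inner_smul_right, hf1, mul_zero, zero_add, hskew]
      _ = - inner ℝ (volterra f) r - ‖volterra f‖ ^ 2 := by
          rw [hr, inner_sub_right, real_inner_self_eq_norm_sq]
          ring
      -- The quadratic term has a favourable sign and is discarded.
      _ ≤ - inner ℝ (volterra f) r := by linarith [sq_nonneg ‖volterra f‖]
      _ = - inner ℝ (volterra f - X.starProjection (volterra f)) r := by
          rw [inner_sub_left, hrX _ (X.starProjection_apply_mem _), sub_zero]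
      _ ≤ ‖volterra f - X.starProjection (volterra f)‖ * ‖r‖ := by
          rw [← inner_neg_left, ← norm_neg (_ - _)]
          exact real_inner_le_norm _ _
      _ ≤ h * ‖f‖ * ‖r‖ := mul_le_mul_of_nonneg_right (hX f) (norm_nonneg _)
  have hrn : ‖r‖ ≤ ‖g‖ + ‖f‖ :=
    (norm_sub_le _ _).trans (add_le_add_right (norm_volterra_le f) _)
  rcases (norm_nonneg f).eq_or_lt with h0 | h0
  · rw [← h0]; positivity
  · refine le_trans (b := h * ‖r‖) ?_ (mul_le_mul_of_nonneg_left hrn hh)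
    refine le_of_mul_le_mul_right ?_ h0
    nlinarith

end SplineApprox

end

theorem lemma4p4 :
    ∃ c : ℝ, 0 < c ∧ ∀ (n₀ p ℓ : ℕ) [NeZero n₀], 1 ≤ p → p < n₀ →
      ∀ u : SplineApprox.H1,
        ‖SplineApprox.toL2 (u - (SplineApprox.splineProjector n₀ p ℓ u : SplineApprox.H1))‖ ≤
          c * SplineApprox.meshSize n₀ ℓ * ‖u‖ := by
  open SplineApprox in
  -- The `2` arises from bounding both `‖e'‖` and `‖e‖` in `L²` by `‖u‖`.
  refine ⟨2, two_pos, fun n₀ p ℓ _ hp _ u => ?_⟩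
  have hn : 0 < gridCount n₀ ℓ := Nat.mul_pos (NeZero.pos n₀) (by positivity)
  have hmesh : 0 ≤ meshSize n₀ ℓ := by unfold meshSize; positivity
  -- Degree `p - 1`, so that the primitives of elements of `X` are splines of degree `p`.
  obtain ⟨X, _, hXs, -, hX⟩ := exists_spline_subspace hn (p - 1)
  set e : H1 := u - (splineProjector n₀ p ℓ u : H1) with he
  have horth : ∀ v ∈ splineSpace n₀ p ℓ, inner ℝ e v = 0 := fun v hv =>
    (splineSpace n₀ p ℓ).starProjection_inner_eq_zero u v hv
  have hnorm : ‖e‖ ≤ ‖u‖ := by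
    have := (splineSpace n₀ p ℓ).starProjection_orthogonal_val u
    change _ = e at this
    rw [← this]
    exact (splineSpace n₀ p ℓ)ᗮ.norm_starProjection_apply_le u
  have hmain := norm_toL2_le_of_orthogonal X (e := e) hmesh hX
    (horth _ (mem_splineSpace hp (oneL2_mem_splinesL2 _ _)))
    fun σ hσ => horth _ (mem_splineSpace hp (by
      have := volterra_mem_splinesL2 (hXs hσ)
      rwa [Nat.sub_add_cancel hp] at this))
  have hsq := norm_sq_H1 e
  have hd : ‖derivL2 e‖ ≤ ‖e‖ :=
    le_of_sq_le_sq (by rw [hsq]; linarith [sq_nonneg ‖toL2 e‖]) (norm_nonneg _)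
  have hv : ‖toL2 e‖ ≤ ‖e‖ :=
    le_of_sq_le_sq (by rw [hsq]; linarith [sq_nonneg ‖derivL2 e‖]) (norm_nonneg _)
  calc ‖toL2 e‖ ≤ meshSize n₀ ℓ * (‖derivL2 e‖ + ‖toL2 e‖) := hmain
    _ ≤ meshSize n₀ ℓ * (‖u‖ + ‖u‖) := by gcongr <;> linarith
    _ = 2 * meshSize n₀ ℓ * ‖u‖ := by ring
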